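/- Let $n\ge 1$ and let $\gamma$ be the Gaussian measure $d\gamma=(2\pi)^{-n/2}e^{-|x|^2/2}\,dx$ on $\mathbb{R}^n$. For a bounded open set $\Omega\subset\mathbb{R}^n$ with Lipschitz boundary, let $W^{1,2}_0(\Omega,\gamma)$ be the closure of $C_c^\infty(\Omega)$ in the weighted Sobolev space $W^{1,2}(\Omega,\gamma)$, and let $$T_\gamma(\Omega)=\sup\left\{\frac{\left(\int_\Omega w\,d\gamma\right)^2}{\int_\Omega|\nabla w|^2\,d\gamma}\;:\;w\in W^{1,2}_0(\Omega,\gamma)\setminus\{0\}\right\}$$ be its Gaussian torsional rigidity. Let $B_R$ be the open ball of radius $R$ centred at the origin and write $T_\gamma(R)=T_\gamma(B_R)$; this supremum is finite for every $R>0$. For $R>0$ put $I_n(R)=\int_0^R s^{n-1}e^{-s^2/2}\,ds$ and $$\alpha_n(R)=\frac{R^{2n-2}e^{-R^2}}{I_n(R)^3}\int_0^R\frac{I_n(t)^2}{t^{n-1}e^{-t^2/2}}\,dt\left[\frac{n-1-R^2}{R^ne^{-R^2/2}}\,I_n(R)-2\right]+1,\qquad \alpha_n=\sup_{R>0}\alpha_n(R).$$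 Then $T_\gamma(\cdot)$ is twice continuously differentiable on $(0,\infty)$ with $T_\gamma'(R)\neq 0$ and $$\alpha_n(R)=1-\frac{T_\gamma(R)\,T_\gamma''(R)}{T_\gamma'(R)^2}\qquad\text{for all }R>0,$$ the supremum $\alpha_n$ is finite, and for all $R_0,R_1>0$ and $t\in[0,1]$, with $R_t=(1-t)R_0+tR_1$, $$T_\gamma(B_{R_t})^{\alpha_n}\le(1-t)\,T_\gamma(B_{R_0})^{\alpha_n}+t\,T_\gamma(B_{R_1})^{\alpha_n}.$$ Moreover $\alpha_n$ is the smallest positive exponent with this property: for $a>0$, the function $R\mapsto T_\gamma(B_R)^a$ is convex on $(0,\infty)$ if and only if $a\ge\alpha_n$. Finally, $$\frac1{n+2}\le\alpha_n\le\sup_{m\ge1}\alpha_m=\frac13,$$ and for $n=1$ the first inequality is an equality, i.e. $\alpha_1=\frac13$. -/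

import Mathlib

open MeasureTheory Set Filter Topology
open scoped ContDiff

noncomputable section

namespace GaussTorsion

/-- The space `ℝⁿ` with its Euclidean norm. -/
abbrev Rn (n : ℕ) : Type := EuclideanSpace ℝ (Fin n)

/-- The Gaussian measure `dγ = (2π)^(-n/2) exp(-|x|²/2) dx` on `ℝⁿ`. -/
def gauss (n : ℕ) : Measure (Rn n) :=
  (volume : Measure (Rn n)).withDensity fun x =>
    ENNReal.ofReal ((2 * Real.pi) ^ (-(n : ℝ) / 2) * Real.exp (-‖x‖ ^ 2 / 2))

/-- `φ ∈ C_c^∞(Ω)`. -/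
def IsTest {n : ℕ} (Ω : Set (Rn n)) (φ : Rn n → ℝ) : Prop :=
  ContDiff ℝ ∞ φ ∧ HasCompactSupport φ ∧ tsupport φ ⊆ Ω

/-- `g` is a weak gradient of `w` on `Ω`: in every direction `v`,
`∫_Ω w ∂_v φ dx = - ∫_Ω ⟨g, v⟩ φ dx` for all `φ ∈ C_c^∞(Ω)`. -/
def IsWeakGradient {n : ℕ} (Ω : Set (Rn n)) (w : Rn n → ℝ) (g : Rn n → Rn n) : Prop :=
  ∀ φ : Rn n → ℝ, IsTest Ω φ → ∀ v : Rn n,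
    ∫ x in Ω, w x * fderiv ℝ φ x v = -∫ x in Ω, inner ℝ (g x) v * φ x

/-- `w ∈ W^{1,2}(Ω, γ)` with weak gradient `g`. -/
def MemW {n : ℕ} (Ω : Set (Rn n)) (w : Rn n → ℝ) (g : Rn n → Rn n) : Prop :=
  MemLp w 2 ((gauss n).restrict Ω) ∧ MemLp g 2 ((gauss n).restrict Ω) ∧ IsWeakGradient Ω w g

/-- `w ∈ W_0^{1,2}(Ω, γ)` with weak gradient `g`: the function `w` belongs to the closure of
`C_c^∞(Ω)` in `W^{1,2}(Ω, γ)`. -/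
def MemWZero {n : ℕ} (Ω : Set (Rn n)) (w : Rn n → ℝ) (g : Rn n → Rn n) : Prop :=
  MemW Ω w g ∧ ∃ φ : ℕ → Rn n → ℝ, (∀ k, IsTest Ω (φ k)) ∧
    Tendsto (fun k => eLpNorm (fun x => φ k x - w x) 2 ((gauss n).restrict Ω)) atTop (𝓝 0) ∧
    Tendsto (fun k => eLpNorm (fun x => gradient (φ k) x - g x) 2 ((gauss n).restrict Ω))
      atTop (𝓝 0)

/-- The quotients `(∫_Ω w dγ)² / ∫_Ω |∇w|² dγ`, for `w ∈ W_0^{1,2}(Ω, γ)` with nonzero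
denominator. -/
def torsionQuotients {n : ℕ} (Ω : Set (Rn n)) : Set ℝ :=
  {q | ∃ (w : Rn n → ℝ) (g : Rn n → Rn n), MemWZero Ω w g ∧
    0 < ∫ x in Ω, ‖g x‖ ^ 2 ∂(gauss n) ∧
    q = (∫ x in Ω, w x ∂(gauss n)) ^ 2 / ∫ x in Ω, ‖g x‖ ^ 2 ∂(gauss n)}

/-- The Gaussian torsional rigidity `T_γ(Ω)`. -/
def torsion {n : ℕ} (Ω : Set (Rn n)) : ℝ := sSup (torsionQuotients Ω)

/-- `R ↦ T_γ(B_R)`, with `B_R` the ball of radius `R` in `ℝⁿ` centred at the origin. -/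
def ballTorsion (n : ℕ) (R : ℝ) : ℝ := torsion (Metric.ball (0 : Rn n) R)

/-- `∫_0^R s^(n-1) exp(-s²/2) ds`; used for `n ≥ 1`. -/
def radial (n : ℕ) (R : ℝ) : ℝ := ∫ s in (0 : ℝ)..R, s ^ (n - 1) * Real.exp (-s ^ 2 / 2)

/-- The explicit expression `α_n(R)`; used for `n ≥ 1` and `R > 0`. -/
def alphaAt (n : ℕ) (R : ℝ) : ℝ :=
  R ^ (2 * n - 2) * Real.exp (-R ^ 2) / radial n R ^ 3 *
      (∫ t in (0 : ℝ)..R, radial n t ^ 2 / (t ^ (n - 1) * Real.exp (-t ^ 2 / 2))) *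
      (((n : ℝ) - 1 - R ^ 2) / (R ^ n * Real.exp (-R ^ 2 / 2)) * radial n R - 2) + 1

/-- The exponent `α_n = sup_{R > 0} α_n(R)`. -/
def alpha (n : ℕ) : ℝ := sSup (alphaAt n '' Ioi 0)

end GaussTorsion

end

noncomputable section

namespace GaussTorsion

/-! ### The radial density and its primitive -/

/-! Write n = m + 1, p = `dens m`, I = `radial (m + 1)`, so I' = p, and G = `profile m`, so G' =
I²/p.

Torsion of balls: the torsion function of a ball is radial with slope -I/p, which gives T_γ(B_R) = c
G(R), c = `areaConst m` (`ballTorsion_eq`). The upper bound comes from integrating by parts along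
rays, which turns the integral of a test function into a pairing of its gradient with a radial field
of length I/p, and then from Cauchy–Schwarz (`IsTest.sq_integral_le`). The lower bound comes from
test functions whose slope is a cut-off of -I/p (`exists_quotient`).

Convexity: α_n(R) = 1 - G G''/G'², hence (G^a)'' = a G^(a-2) G'² (a - α_n(R)), and G^a is convex
exactly when a ≥ sup α_n (`convexOn_profile_rpow_iff`).

Bounds: α_n(R) ≤ 1/3 means G ≥ (2/3) G'²/G''. Both sides tend to 0 at 0 and their difference has an
explicitly nonnegative derivative (`le_profile_sharp`). Near 0, G behaves like a multiple of
R^(n+2), so α_n(R) → 1/(n+2) (`tendsto_alphaAt`). For n = 1 the two bounds coincide, which settles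
α_1 and the supremum over n. -/

/-- The radial density `r ↦ r ^ m * exp (-r² / 2)` of the Gaussian measure on `ℝ^(m + 1)`. -/
def dens (m : ℕ) (r : ℝ) : ℝ := r ^ m * Real.exp (-r ^ 2 / 2)

/-- The torsion of the ball of radius `R` in `ℝ^(m + 1)`, up to the area of the unit sphere. -/
def profile (m : ℕ) (R : ℝ) : ℝ := ∫ t in (0 : ℝ)..R, radial (m + 1) t ^ 2 / dens m t

lemma contDiff_dens (m : ℕ) {k : WithTop ℕ∞} : ContDiff ℝ k (dens m) := by
  unfold dens; fun_prop

lemma continuous_dens (m : ℕ) : Continuous (dens m) := (contDiff_dens m (k := 0)).continuous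

lemma dens_pos (m : ℕ) {r : ℝ} (hr : 0 < r) : 0 < dens m r := by
  unfold dens; positivity

lemma radial_succ (m : ℕ) (R : ℝ) : radial (m + 1) R = ∫ s in (0 : ℝ)..R, dens m s := rfl

lemma radial_zero (m : ℕ) : radial (m + 1) 0 = 0 := by simp [radial_succ]

lemma hasDerivAt_radial (m : ℕ) (R : ℝ) : HasDerivAt (radial (m + 1)) (dens m R) R :=
  intervalIntegral.integral_hasDerivAt_right ((continuous_dens m).intervalIntegrable _ _)
    ((continuous_dens m).stronglyMeasurableAtFilter _ _) (continuous_dens m).continuousAt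

lemma continuous_radial (m : ℕ) : Continuous (radial (m + 1)) :=
  continuous_iff_continuousAt.2 fun R => (hasDerivAt_radial m R).continuousAt

lemma contDiff_radial (m : ℕ) : ContDiff ℝ ∞ (radial (m + 1)) := by
  rw [contDiff_infty_iff_deriv]
  refine ⟨fun R => (hasDerivAt_radial m R).differentiableAt, ?_⟩
  rw [show deriv (radial (m + 1)) = dens m from funext fun R => (hasDerivAt_radial m R).deriv]
  exact contDiff_dens m

lemma radial_pos (m : ℕ) {R : ℝ} (hR : 0 < R) : 0 < radial (m + 1) R :=
  intervalIntegral.intervalIntegral_pos_of_pos_on ((continuous_dens m).intervalIntegrable _ _)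
    (fun _ hx => dens_pos m hx.1) hR

/-- Written as logarithmic derivative times density, so that all later derivatives are rational in
r, p and I. -/
lemma hasDerivAt_dens (m : ℕ) {r : ℝ} (hr : 0 < r) :
    HasDerivAt (dens m) ((m - r ^ 2) / r * dens m r) r := by
  have h1 : HasDerivAt (fun r : ℝ => Real.exp (-r ^ 2 / 2))
      (Real.exp (-r ^ 2 / 2) * (-(2 * r) / 2)) r := by
    have h0 : HasDerivAt (fun r : ℝ => -r ^ 2 / 2) (-(2 * r) / 2) r := by
      simpa using ((hasDerivAt_pow 2 r).neg.div_const 2)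
    exact h0.exp
  have h2 := (hasDerivAt_pow m r).mul h1
  refine h2.congr_deriv ?_
  unfold dens
  rcases m with _ | m
  · simp; field_simp
  · simp only [Nat.add_sub_cancel, Nat.cast_add, Nat.cast_one]
    field_simp
    ring

/-- This bound and the next one agree to leading order at 0; the limits at 0 below are squeezes
built on them. -/
lemma radial_le (m : ℕ) {R : ℝ} (hR : 0 ≤ R) : radial (m + 1) R ≤ R ^ (m + 1) / (m + 1) := by
  have h : ∫ s in (0 : ℝ)..R, s ^ m = R ^ (m + 1) / (m + 1) := by simp [integral_pow]
  rw [radial_succ, ← h]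
  refine intervalIntegral.integral_mono_on hR ((continuous_dens m).intervalIntegrable _ _)
    ((continuous_pow m).intervalIntegrable _ _) fun s hs => ?_
  exact mul_le_of_le_one_right (pow_nonneg hs.1 _) (Real.exp_le_one_iff.2 (by nlinarith [sq_nonneg s]))

lemma le_radial (m : ℕ) {R : ℝ} (hR : 0 ≤ R) :
    R ^ (m + 1) / (m + 1) * Real.exp (-R ^ 2 / 2) ≤ radial (m + 1) R := by
  have h : ∫ s in (0 : ℝ)..R, s ^ m * Real.exp (-R ^ 2 / 2) =
      R ^ (m + 1) / (m + 1) * Real.exp (-R ^ 2 / 2) := by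
    rw [intervalIntegral.integral_mul_const]; simp [integral_pow]
  rw [radial_succ, ← h]
  refine intervalIntegral.integral_mono_on hR ((by fun_prop : Continuous _).intervalIntegrable _ _)
    ((continuous_dens m).intervalIntegrable _ _) fun s hs => ?_
  refine mul_le_mul_of_nonneg_left (Real.exp_le_exp.2 ?_) (pow_nonneg hs.1 _)
  nlinarith [hs.1, hs.2]

lemma radial_nonneg (m : ℕ) {R : ℝ} (hR : 0 ≤ R) : 0 ≤ radial (m + 1) R :=
  (by positivity : (0 : ℝ) ≤ _).trans (le_radial m hR)

/-- The density is log-concave, so its logarithmic derivative is at most `dens / radial`. -/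
lemma mul_radial_le (m : ℕ) {R : ℝ} (hR : 0 < R) :
    (m - R ^ 2) * radial (m + 1) R ≤ R * dens m R := by
  have hc : Continuous fun r : ℝ => r * dens m r - (m - r ^ 2) * radial (m + 1) r := by
    have := continuous_dens m
    have := continuous_radial m
    fun_prop
  have hd : ∀ r ∈ Ioi (0 : ℝ), HasDerivAt
      (fun r : ℝ => r * dens m r - (m - r ^ 2) * radial (m + 1) r)
      (dens m r + 2 * r * radial (m + 1) r) r := fun r hr => by
    have hr : 0 < r := hr
    have h1 := (hasDerivAt_id r).mul (hasDerivAt_dens m hr)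
    have h2 := ((hasDerivAt_pow 2 r).const_sub (m : ℝ)).mul (hasDerivAt_radial m r)
    refine (h1.sub h2).congr_deriv ?_
    simp only [id]
    field_simp
    ring
  have hm : MonotoneOn (fun r : ℝ => r * dens m r - (m - r ^ 2) * radial (m + 1) r) (Ici 0) := by
    refine monotoneOn_of_deriv_nonneg (convex_Ici 0) hc.continuousOn ?_ ?_
    · rw [interior_Ici]
      exact fun r hr => (hd r hr).differentiableAt.differentiableWithinAt
    · rw [interior_Ici]
      intro r hr
      rw [(hd r hr).deriv]
      have := dens_pos m hr
      have := radial_pos m hr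
      have hr : 0 < r := hr
      positivity
  have := hm (mem_Ici.2 le_rfl) (mem_Ici.2 hR.le) hR.le
  simp only [radial_zero] at this
  linarith

/-! ### The profile -/

lemma integrand_nonneg (m : ℕ) {t : ℝ} (ht : 0 ≤ t) : 0 ≤ radial (m + 1) t ^ 2 / dens m t := by
  unfold dens; positivity

lemma integrand_le (m : ℕ) {t : ℝ} (ht : 0 ≤ t) :
    radial (m + 1) t ^ 2 / dens m t ≤ t ^ (m + 2) / (m + 1) ^ 2 * Real.exp (t ^ 2 / 2) := by
  rcases ht.eq_or_lt with rfl | ht'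
  · simp [radial_zero]
  rw [div_le_iff₀ (dens_pos m ht')]
  calc radial (m + 1) t ^ 2 ≤ (t ^ (m + 1) / (m + 1)) ^ 2 :=
        pow_le_pow_left₀ (radial_nonneg m ht) (radial_le m ht) 2
    _ = t ^ (m + 2) / (m + 1) ^ 2 * (Real.exp (t ^ 2 / 2) * Real.exp (-t ^ 2 / 2)) * t ^ m := by
        rw [← Real.exp_add, show t ^ 2 / 2 + -t ^ 2 / 2 = 0 by ring, Real.exp_zero, div_pow]; ring
    _ = _ := by unfold dens; ring

lemma le_integrand (m : ℕ) {t : ℝ} (ht : 0 ≤ t) :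
    t ^ (m + 2) / (m + 1) ^ 2 * Real.exp (-t ^ 2) ≤ radial (m + 1) t ^ 2 / dens m t := by
  rcases ht.eq_or_lt with rfl | ht'
  · simp [radial_zero]
  rw [le_div_iff₀ (dens_pos m ht')]
  calc _ = t ^ (m + 2) / (m + 1) ^ 2 * Real.exp (-t ^ 2) * t ^ m * Real.exp (-t ^ 2 / 2) := by
        unfold dens; ring
    _ ≤ t ^ (m + 2) / (m + 1) ^ 2 * Real.exp (-t ^ 2) * t ^ m * 1 := by
        refine mul_le_mul_of_nonneg_left (Real.exp_le_one_iff.2 ?_) (by positivity)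
        nlinarith [sq_nonneg t]
    _ = (t ^ (m + 1) / (m + 1) * Real.exp (-t ^ 2 / 2)) ^ 2 := by
        rw [mul_pow, ← Real.exp_nat_mul, div_pow,
          show ((2 : ℕ) : ℝ) * (-t ^ 2 / 2) = -t ^ 2 by push_cast; ring]
        ring
    _ ≤ _ := pow_le_pow_left₀ (by positivity) (le_radial m ht) 2

lemma continuousAt_integrand (m : ℕ) {t : ℝ} (ht : 0 < t) :
    ContinuousAt (fun t => radial (m + 1) t ^ 2 / dens m t) t :=
  ((continuous_radial m).continuousAt.pow 2).div (continuous_dens m).continuousAt (dens_pos m ht).ne'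

lemma continuousOn_integrand (m : ℕ) :
    ContinuousOn (fun t => radial (m + 1) t ^ 2 / dens m t) (Ici 0) := by
  intro t ht
  rcases (mem_Ici.1 ht).eq_or_lt with rfl | ht'
  · rw [ContinuousWithinAt]
    simp only [radial_zero]
    have hb : Tendsto (fun t : ℝ => t ^ (m + 2) / (m + 1) ^ 2 * Real.exp (t ^ 2 / 2))
        (𝓝[Ici 0] 0) (𝓝 0) := by
      have : Continuous fun t : ℝ => t ^ (m + 2) / ((m : ℝ) + 1) ^ 2 * Real.exp (t ^ 2 / 2) := by
        fun_prop
      have h := this.tendsto 0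
      simp only [ne_eq, Nat.add_eq_zero_iff, OfNat.ofNat_ne_zero, and_false, not_false_eq_true,
        zero_pow, zero_div, zero_mul] at h
      exact h.mono_left nhdsWithin_le_nhds
    -- For m ≥ 1 the quotient at 0 is 0/0; its default value 0 is also the limit.
    rw [show (0 : ℝ) ^ 2 / dens m 0 = 0 by simp]
    refine squeeze_zero' ?_ ?_ hb
    · filter_upwards [self_mem_nhdsWithin] with t ht using integrand_nonneg m ht
    · filter_upwards [self_mem_nhdsWithin] with t ht using integrand_le m ht
  · exact (continuousAt_integrand m ht').continuousWithinAt

lemma intervalIntegrable_integrand (m : ℕ) {a b : ℝ} (ha : 0 ≤ a) (hb : 0 ≤ b) :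
    IntervalIntegrable (fun t => radial (m + 1) t ^ 2 / dens m t) volume a b :=
  ((continuousOn_integrand m).mono fun _ hx => (le_min ha hb).trans hx.1).intervalIntegrable

lemma hasDerivAt_profile (m : ℕ) {R : ℝ} (hR : 0 < R) :
    HasDerivAt (profile m) (radial (m + 1) R ^ 2 / dens m R) R := by
  refine intervalIntegral.integral_hasDerivAt_right
    (intervalIntegrable_integrand m le_rfl hR.le) ?_ (continuousAt_integrand m hR)
  refine ContinuousOn.stronglyMeasurableAtFilter isOpen_Ioi
    ((continuousOn_integrand m).mono Ioi_subset_Ici_self) R hR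

lemma le_profile (m : ℕ) {R : ℝ} (hR : 0 ≤ R) :
    R ^ (m + 3) / ((m + 3) * (m + 1) ^ 2) * Real.exp (-R ^ 2) ≤ profile m R := by
  have h : ∫ s in (0 : ℝ)..R, s ^ (m + 2) * (((m : ℝ) + 1) ^ 2)⁻¹ * Real.exp (-R ^ 2) =
      R ^ (m + 3) / ((m + 3) * (m + 1) ^ 2) * Real.exp (-R ^ 2) := by
    rw [intervalIntegral.integral_mul_const, intervalIntegral.integral_mul_const]
    rw [integral_pow, show ((m + 2 : ℕ) : ℝ) + 1 = m + 3 by push_cast; ring]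
    field_simp
    simp
  rw [profile, ← h]
  refine intervalIntegral.integral_mono_on hR ((by fun_prop : Continuous _).intervalIntegrable _ _)
    (intervalIntegrable_integrand m le_rfl hR) fun s hs => le_trans ?_ (le_integrand m hs.1)
  rw [← div_eq_mul_inv]
  refine mul_le_mul_of_nonneg_left (Real.exp_le_exp.2 ?_) (div_nonneg (pow_nonneg hs.1 _) (by positivity))
  nlinarith [hs.1, hs.2]

lemma profile_le (m : ℕ) {R : ℝ} (hR : 0 ≤ R) :
    profile m R ≤ R ^ (m + 3) / ((m + 3) * (m + 1) ^ 2) * Real.exp (R ^ 2 / 2) := by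
  have h : ∫ s in (0 : ℝ)..R, s ^ (m + 2) * (((m : ℝ) + 1) ^ 2)⁻¹ * Real.exp (R ^ 2 / 2) =
      R ^ (m + 3) / ((m + 3) * (m + 1) ^ 2) * Real.exp (R ^ 2 / 2) := by
    rw [intervalIntegral.integral_mul_const, intervalIntegral.integral_mul_const]
    rw [integral_pow, show ((m + 2 : ℕ) : ℝ) + 1 = m + 3 by push_cast; ring]
    field_simp
    simp
  rw [profile, ← h]
  refine intervalIntegral.integral_mono_on hR (intervalIntegrable_integrand m le_rfl hR)
    ((by fun_prop : Continuous _).intervalIntegrable _ _) fun s hs => (integrand_le m hs.1).trans ?_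
  rw [← div_eq_mul_inv]
  refine mul_le_mul_of_nonneg_left (Real.exp_le_exp.2 ?_) (div_nonneg (pow_nonneg hs.1 _) (by positivity))
  nlinarith [hs.1, hs.2]

lemma profile_pos (m : ℕ) {R : ℝ} (hR : 0 < R) : 0 < profile m R :=
  (by positivity : (0 : ℝ) < _).trans_le (le_profile m hR.le)

lemma tendsto_profile_zero (m : ℕ) : Tendsto (profile m) (𝓝[>] 0) (𝓝 0) := by
  have hb : Tendsto (fun R : ℝ => R ^ (m + 3) / (((m : ℝ) + 3) * (m + 1) ^ 2) * Real.exp (R ^ 2 / 2))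
      (𝓝[>] 0) (𝓝 0) := by
    have : Continuous fun R : ℝ => R ^ (m + 3) / (((m : ℝ) + 3) * (m + 1) ^ 2) *
      Real.exp (R ^ 2 / 2) := by fun_prop
    simpa using (this.tendsto 0).mono_left (nhdsWithin_le_nhds (s := Ioi 0))
  refine squeeze_zero' ?_ ?_ hb
  · filter_upwards [self_mem_nhdsWithin] with t ht using (profile_pos m ht).le
  · filter_upwards [self_mem_nhdsWithin] with t ht using profile_le m (le_of_lt ht)

/-! ### The exponent `α` -/

lemma alphaAt_eq (m : ℕ) (R : ℝ) :
    alphaAt (m + 1) R = 1 - profile m R * dens m R ^ 2 / radial (m + 1) R ^ 3 *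
      (2 - (m - R ^ 2) / (R * dens m R) * radial (m + 1) R) := by
  have h1 : R ^ (2 * (m + 1) - 2) * Real.exp (-R ^ 2) = dens m R ^ 2 := by
    unfold dens
    rw [mul_pow, ← Real.exp_nat_mul, ← pow_mul]
    congr 1
    · congr 1; omega
    · congr 1; push_cast; ring
  have h2 : R ^ (m + 1) * Real.exp (-R ^ 2 / 2) = R * dens m R := by unfold dens; ring
  unfold alphaAt
  rw [h1, h2]
  -- The integral in `alphaAt` is `profile m R` by definition, since `m + 1 - 1` reduces to `m`.
  change _ * profile m R * _ + 1 = _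
  push_cast
  ring

/-- With D = 2Rp - (m - R²)I one has G'' = I D/(R p), so this is strict convexity of G in
quantitative form. -/
lemma dens_le_two_mul_sub (m : ℕ) {R : ℝ} (hR : 0 < R) :
    R * dens m R ≤ 2 * R * dens m R - (m - R ^ 2) * radial (m + 1) R := by
  linarith [mul_radial_le m hR]

/-- The left side is K = (2/3) G'²/G''. The constant 2/3 cannot be raised for m = 0, where both
sides are asymptotic to R³/3 at 0. -/
lemma le_profile_sharp (m : ℕ) {R : ℝ} (hR : 0 < R) :
    2 / 3 * (radial (m + 1) R ^ 3 * R /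
      (dens m R * (2 * R * dens m R - (m - R ^ 2) * radial (m + 1) R))) ≤ profile m R := by
  set K : ℝ → ℝ := fun R => 2 / 3 * (radial (m + 1) R ^ 3 * R /
      (dens m R * (2 * R * dens m R - (m - R ^ 2) * radial (m + 1) R))) with hK
  have hpos : ∀ r : ℝ, 0 < r → 0 < 2 * r * dens m r - (m - r ^ 2) * radial (m + 1) r :=
    fun r hr => (mul_pos hr (dens_pos m hr)).trans_le (dens_le_two_mul_sub m hr)
  have hd : ∀ r ∈ Ioi (0 : ℝ), ∃ d, 0 ≤ d ∧ HasDerivAt (fun r => profile m r - K r) d r := by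
    intro r hr
    have hr : 0 < r := hr
    have hp := dens_pos m hr
    have hD := hpos r hr
    have h1 := ((hasDerivAt_radial m r).pow 3).mul (hasDerivAt_id r)
    have h2 := (((hasDerivAt_id r).const_mul 2).mul (hasDerivAt_dens m hr)).sub
      (((hasDerivAt_pow 2 r).const_sub (m : ℝ)).mul (hasDerivAt_radial m r))
    have h3 := (hasDerivAt_dens m hr).mul h2
    have h4 := (hasDerivAt_profile m hr).sub
      ((h1.div h3 (mul_pos hp hD).ne').const_mul (2 / 3 : ℝ))
    refine ⟨_, ?_, h4⟩
    simp only [Pi.mul_apply, Pi.sub_apply, Pi.pow_apply, id]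
    generalize radial (m + 1) r = I at *
    generalize dens m r = p at *
    -- Over a common denominator G' - K' becomes a square plus nonnegative terms.
    have key : I ^ 2 / p - 2 / 3 * (((3 * I ^ 2 * p * r + I ^ 3 * 1) *
        (p * (2 * r * p - (m - r ^ 2) * I)) - I ^ 3 * r *
        ((m - r ^ 2) / r * p * (2 * r * p - (m - r ^ 2) * I) + p * (2 * 1 * p + 2 * r *
        ((m - r ^ 2) / r * p) - (-(2 * r) * I + (m - r ^ 2) * p)))) /
        (p * (2 * r * p - (m - r ^ 2) * I)) ^ 2) =
        I ^ 4 * (1 / 3 * (m - r ^ 2) ^ 2 + 2 / 3 * (m + r ^ 2)) /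
        (p * (2 * r * p - (m - r ^ 2) * I) ^ 2) := by
      have hD' := hD.ne'
      -- D stays an atom while denominators are cleared and is expanded only for `ring`.
      generalize hDD : 2 * r * p - (m - r ^ 2) * I = D at *
      have hpn := hp.ne'
      field_simp
      subst hDD
      ring
    refine le_of_le_of_eq (b := I ^ 4 * (1 / 3 * (m - r ^ 2) ^ 2 + 2 / 3 * (m + r ^ 2)) /
        (p * (2 * r * p - (m - r ^ 2) * I) ^ 2)) (by positivity) (key.symm.trans ?_)
    norm_num
  have hm : MonotoneOn (fun r => profile m r - K r) (Ioi 0) := by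
    refine monotoneOn_of_deriv_nonneg (convex_Ioi 0) ?_ ?_ ?_
    · intro r hr
      obtain ⟨d, -, h⟩ := hd r hr
      exact h.continuousAt.continuousWithinAt
    · rw [interior_Ioi]
      intro r hr
      obtain ⟨d, -, h⟩ := hd r hr
      exact h.differentiableAt.differentiableWithinAt
    · rw [interior_Ioi]
      intro r hr
      obtain ⟨d, h0, h⟩ := hd r hr
      rwa [h.deriv]
  have hK0 : Tendsto K (𝓝[>] 0) (𝓝 0) := by
    -- This majorant of K comes from I ≤ r^(m+1)/(m+1) and D ≥ r p.
    have hb : Tendsto (fun r : ℝ => 2 / 3 * (r ^ (m + 3) / (m + 1) ^ 3 * Real.exp (r ^ 2)))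
        (𝓝[>] 0) (𝓝 0) := by
      have : Continuous fun r : ℝ => 2 / 3 * (r ^ (m + 3) / ((m : ℝ) + 1) ^ 3 * Real.exp (r ^ 2)) := by
        fun_prop
      simpa using (this.tendsto 0).mono_left (nhdsWithin_le_nhds (s := Ioi 0))
    refine squeeze_zero' ?_ ?_ hb
    · filter_upwards [self_mem_nhdsWithin] with r hr
      have hr : 0 < r := hr
      have := hpos r hr
      have := dens_pos m hr
      have := radial_pos m hr
      positivity
    · filter_upwards [self_mem_nhdsWithin] with r hr
      have hr : 0 < r := hr
      have h1 := hpos r hr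
      have h2 := dens_pos m hr
      have h3 := radial_pos m hr
      refine mul_le_mul_of_nonneg_left ?_ (by norm_num)
      rw [div_le_iff₀ (by positivity)]
      calc radial (m + 1) r ^ 3 * r ≤ (r ^ (m + 1) / (m + 1)) ^ 3 * r :=
            mul_le_mul_of_nonneg_right (pow_le_pow_left₀ h3.le (radial_le m hr.le) 3) hr.le
        _ = r ^ (m + 3) / (m + 1) ^ 3 * Real.exp (r ^ 2) * (dens m r * (r * dens m r)) := by
          have : Real.exp (r ^ 2) * (Real.exp (-r ^ 2 / 2) * Real.exp (-r ^ 2 / 2)) = 1 := by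
            rw [← Real.exp_add, ← Real.exp_add]; ring_nf; simp
          unfold dens
          rw [div_pow]
          linear_combination (-(r ^ (m + 3) / (m + 1) ^ 3 * r ^ m * r * r ^ m)) * this
        _ ≤ _ := by
          refine mul_le_mul_of_nonneg_left ?_ (by positivity)
          exact mul_le_mul_of_nonneg_left (dens_le_two_mul_sub m hr) h2.le
  have hlim : Tendsto (fun r => profile m r - K r) (𝓝[>] 0) (𝓝 0) := by
    simpa using (tendsto_profile_zero m).sub hK0
  have : 0 ≤ profile m R - K R := by
    refine le_of_tendsto hlim ?_
    filter_upwards [Ioo_mem_nhdsGT hR] with r hr using hm hr.1 hR hr.2.le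
  exact sub_nonneg.1 this

lemma alphaAt_le (m : ℕ) {R : ℝ} (hR : 0 < R) : alphaAt (m + 1) R ≤ 1 / 3 := by
  rw [alphaAt_eq m R]
  have h := le_profile_sharp m hR
  have h2 := dens_pos m hR
  have h3 := radial_pos m hR
  have hD := (mul_pos hR h2).trans_le (dens_le_two_mul_sub m hR)
  have e : profile m R * dens m R ^ 2 / radial (m + 1) R ^ 3 *
      (2 - (m - R ^ 2) / (R * dens m R) * radial (m + 1) R) =
      profile m R / (radial (m + 1) R ^ 3 * R /
      (dens m R * (2 * R * dens m R - (m - R ^ 2) * radial (m + 1) R))) := by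
    field_simp
  rw [e]
  have : 2 / 3 ≤ profile m R / (radial (m + 1) R ^ 3 * R /
      (dens m R * (2 * R * dens m R - (m - R ^ 2) * radial (m + 1) R))) := by
    rw [le_div_iff₀ (by positivity)]
    exact h
  linarith

/-- For a pure power R^k the expression 1 - G G''/G'² equals 1/k, and G is asymptotic to a multiple
of R^(m+3). The proof divides I by R^(m+1) and G by R^(m+3) and takes limits factor by factor. -/
lemma tendsto_alphaAt (m : ℕ) :
    Tendsto (alphaAt (m + 1)) (𝓝[>] 0) (𝓝 (1 / ((m : ℝ) + 3))) := by
  have hA : Tendsto (fun R => radial (m + 1) R / R ^ (m + 1)) (𝓝[>] 0) (𝓝 (1 / ((m : ℝ) + 1))) := by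
    have hb : Tendsto (fun R : ℝ => 1 / ((m : ℝ) + 1) * Real.exp (-R ^ 2 / 2)) (𝓝[>] 0)
        (𝓝 (1 / ((m : ℝ) + 1))) := by
      have : Continuous fun R : ℝ => 1 / ((m : ℝ) + 1) * Real.exp (-R ^ 2 / 2) := by fun_prop
      simpa using (this.tendsto 0).mono_left (nhdsWithin_le_nhds (s := Ioi 0))
    refine tendsto_of_tendsto_of_tendsto_of_le_of_le' hb tendsto_const_nhds ?_ ?_
    · filter_upwards [self_mem_nhdsWithin] with R hR
      have hR : 0 < R := hR
      rw [le_div_iff₀ (by positivity)]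
      exact le_of_eq_of_le (by ring) (le_radial m hR.le)
    · filter_upwards [self_mem_nhdsWithin] with R hR
      have hR : 0 < R := hR
      rw [div_le_iff₀ (by positivity)]
      exact le_of_le_of_eq (radial_le m hR.le) (by ring)
  have hB : Tendsto (fun R => profile m R / R ^ (m + 3)) (𝓝[>] 0)
      (𝓝 (1 / (((m : ℝ) + 3) * (m + 1) ^ 2))) := by
    have hb : Tendsto (fun R : ℝ => 1 / (((m : ℝ) + 3) * (m + 1) ^ 2) * Real.exp (-R ^ 2)) (𝓝[>] 0)
        (𝓝 (1 / (((m : ℝ) + 3) * (m + 1) ^ 2))) := by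
      have : Continuous fun R : ℝ => 1 / (((m : ℝ) + 3) * (m + 1) ^ 2) * Real.exp (-R ^ 2) := by
        fun_prop
      simpa using (this.tendsto 0).mono_left (nhdsWithin_le_nhds (s := Ioi 0))
    have hb' : Tendsto (fun R : ℝ => 1 / (((m : ℝ) + 3) * (m + 1) ^ 2) * Real.exp (R ^ 2 / 2))
        (𝓝[>] 0) (𝓝 (1 / (((m : ℝ) + 3) * (m + 1) ^ 2))) := by
      have : Continuous fun R : ℝ => 1 / (((m : ℝ) + 3) * (m + 1) ^ 2) * Real.exp (R ^ 2 / 2) := by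
        fun_prop
      simpa using (this.tendsto 0).mono_left (nhdsWithin_le_nhds (s := Ioi 0))
    refine tendsto_of_tendsto_of_tendsto_of_le_of_le' hb hb' ?_ ?_
    · filter_upwards [self_mem_nhdsWithin] with R hR
      have hR : 0 < R := hR
      rw [le_div_iff₀ (by positivity)]
      exact le_of_eq_of_le (by ring) (le_profile m hR.le)
    · filter_upwards [self_mem_nhdsWithin] with R hR
      have hR : 0 < R := hR
      rw [div_le_iff₀ (by positivity)]
      exact le_of_le_of_eq (profile_le m hR.le) (by ring)
  have hE : Tendsto (fun R : ℝ => Real.exp (-R ^ 2 / 2)) (𝓝[>] 0) (𝓝 1) := by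
    have : Continuous fun R : ℝ => Real.exp (-R ^ 2 / 2) := by fun_prop
    simpa using (this.tendsto 0).mono_left (nhdsWithin_le_nhds (s := Ioi 0))
  have hQ : Tendsto (fun R : ℝ => (m : ℝ) - R ^ 2) (𝓝[>] 0) (𝓝 m) := by
    have : Continuous fun R : ℝ => (m : ℝ) - R ^ 2 := by fun_prop
    simpa using (this.tendsto 0).mono_left (nhdsWithin_le_nhds (s := Ioi 0))
  have hm : (1 / ((m : ℝ) + 1)) ^ 3 ≠ 0 := by positivity
  have hlim := tendsto_const_nhds (x := (1 : ℝ)) |>.sub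
    (((hB.mul (hE.pow 2)).div (hA.pow 3) hm).mul
      (tendsto_const_nhds (x := (2 : ℝ)) |>.sub ((hQ.mul hA).div hE one_ne_zero)))
  have hval : 1 - 1 / (((m : ℝ) + 3) * (m + 1) ^ 2) * 1 ^ 2 / (1 / ((m : ℝ) + 1)) ^ 3 *
      (2 - m * (1 / ((m : ℝ) + 1)) / 1) = 1 / (m + 3) := by
    field_simp
    ring
  rw [hval] at hlim
  refine hlim.congr' ?_
  filter_upwards [self_mem_nhdsWithin] with R hR
  have hR : 0 < R := hR
  rw [alphaAt_eq m R]
  have h3 := (radial_pos m hR).ne'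
  have he := (Real.exp_pos (-R ^ 2 / 2)).ne'
  simp only [Pi.div_apply]
  unfold dens
  generalize radial (m + 1) R = I at *
  generalize Real.exp (-R ^ 2 / 2) = E at *
  congr 1
  field_simp
  ring

lemma alpha_isLUB (m : ℕ) : IsLUB (alphaAt (m + 1) '' Ioi 0) (alpha (m + 1)) := by
  refine isLUB_csSup ⟨_, mem_image_of_mem _ (mem_Ioi.2 one_pos)⟩ ⟨1 / 3, ?_⟩
  rintro _ ⟨R, hR, rfl⟩
  exact alphaAt_le m hR

lemma alpha_le (m : ℕ) : alpha (m + 1) ≤ 1 / 3 := by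
  refine (alpha_isLUB m).2 ?_
  rintro _ ⟨R, hR, rfl⟩
  exact alphaAt_le m hR

lemma le_alpha (m : ℕ) : 1 / ((m : ℝ) + 3) ≤ alpha (m + 1) := by
  refine le_of_tendsto (tendsto_alphaAt m) ?_
  filter_upwards [self_mem_nhdsWithin] with R hR
  exact (alpha_isLUB m).1 (mem_image_of_mem _ hR)

/-! ### Convexity of powers of the profile -/

lemma contDiffOn_profile (m : ℕ) : ContDiffOn ℝ 2 (profile m) (Ioi 0) := by
  have h1 : ContDiffOn ℝ 1 (deriv (profile m)) (Ioi 0) := by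
    have : ContDiffOn ℝ 1 (fun t => radial (m + 1) t ^ 2 / dens m t) (Ioi 0) :=
      ContDiffOn.div (((contDiff_radial m).of_le (by simp)).pow 2).contDiffOn
        (contDiff_dens m).contDiffOn fun t ht => (dens_pos m ht).ne'
    exact this.congr fun t ht => (hasDerivAt_profile m ht).deriv
  rw [show (2 : WithTop ℕ∞) = 1 + 1 by norm_num, contDiffOn_succ_iff_deriv_of_isOpen isOpen_Ioi]
  exact ⟨fun t ht => (hasDerivAt_profile m ht).differentiableAt.differentiableWithinAt,
    by simp, h1⟩

lemma hasDerivAt_integrand (m : ℕ) {R : ℝ} (hR : 0 < R) :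
    HasDerivAt (fun t => radial (m + 1) t ^ 2 / dens m t)
      (2 * radial (m + 1) R - (m - R ^ 2) / (R * dens m R) * radial (m + 1) R ^ 2) R := by
  have hp := (dens_pos m hR).ne'
  refine (((hasDerivAt_radial m R).pow 2).div (hasDerivAt_dens m hR) hp).congr_deriv ?_
  simp only [Pi.pow_apply]
  field_simp
  norm_num
  ring

/-- This is the form 1 - G G''/G'², with G'' taken from `hasDerivAt_integrand`. -/
lemma alphaAt_eq_deriv (m : ℕ) {R : ℝ} (hR : 0 < R) :
    alphaAt (m + 1) R = 1 - profile m R *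
      (2 * radial (m + 1) R - (m - R ^ 2) / (R * dens m R) * radial (m + 1) R ^ 2) /
        (radial (m + 1) R ^ 2 / dens m R) ^ 2 := by
  rw [alphaAt_eq m R]
  have h2 := (dens_pos m hR).ne'
  have h3 := (radial_pos m hR).ne'
  field_simp

lemma hasDerivAt_profile_rpow (m : ℕ) (a : ℝ) {R : ℝ} (hR : 0 < R) :
    HasDerivAt (fun R => profile m R ^ a)
      (radial (m + 1) R ^ 2 / dens m R * a * profile m R ^ (a - 1)) R :=
  (hasDerivAt_profile m hR).rpow_const (Or.inl (profile_pos m hR).ne')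

/-- Factor a G^(a-2) G'² out of a G^(a-1) G'' + a (a - 1) G^(a-2) G'². -/
lemma deriv_deriv_profile_rpow (m : ℕ) (a : ℝ) {R : ℝ} (hR : 0 < R) :
    HasDerivAt (deriv fun R => profile m R ^ a)
      (a * profile m R ^ (a - 2) * (radial (m + 1) R ^ 2 / dens m R) ^ 2 *
        (a - alphaAt (m + 1) R)) R := by
  have hT := profile_pos m hR
  have h := ((hasDerivAt_integrand m hR).mul_const a).mul (hasDerivAt_profile_rpow m (a - 1) hR)
  have h' := h.congr_deriv (g' := a * profile m R ^ (a - 2) *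
    (radial (m + 1) R ^ 2 / dens m R) ^ 2 * (a - alphaAt (m + 1) R)) ?_
  · refine h'.congr_of_eventuallyEq ?_
    filter_upwards [Ioi_mem_nhds hR] with t ht using (hasDerivAt_profile_rpow m a ht).deriv
  · rw [alphaAt_eq_deriv m hR]
    have h2 := (div_pos (pow_pos (radial_pos m hR) 2) (dens_pos m hR)).ne'
    have e1 : profile m R ^ (a - 1) = profile m R ^ (a - 2) * profile m R := by
      rw [show a - 1 = a - 2 + 1 by ring, Real.rpow_add_one hT.ne']
    rw [e1, show a - 1 - 1 = a - 2 by ring]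
    generalize radial (m + 1) R ^ 2 / dens m R = q at *
    generalize 2 * radial (m + 1) R - _ = q' at *
    field_simp
    ring

/-- For a > 0 the prefactor of the second derivative is positive, so only the sign of a - α_n(R)
matters. -/
lemma convexOn_profile_rpow_iff (m : ℕ) {a : ℝ} (ha : 0 < a) :
    ConvexOn ℝ (Ioi 0) (fun R => profile m R ^ a) ↔ alpha (m + 1) ≤ a := by
  have hdiff : DifferentiableOn ℝ (fun R => profile m R ^ a) (Ioi 0) := fun R hR =>
    (hasDerivAt_profile_rpow m a hR).differentiableAt.differentiableWithinAt
  have hpos : ∀ R : ℝ, 0 < R →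
      0 < a * profile m R ^ (a - 2) * (radial (m + 1) R ^ 2 / dens m R) ^ 2 := fun R hR => by
    have := profile_pos m hR
    have := radial_pos m hR
    have := dens_pos m hR
    positivity
  constructor
  · intro h
    have hmono := h.monotoneOn_deriv fun R hR => (hasDerivAt_profile_rpow m a hR).differentiableAt
    refine (alpha_isLUB m).2 ?_
    rintro _ ⟨R, hR, rfl⟩
    have h2 := (deriv_deriv_profile_rpow m a hR).hasDerivWithinAt (s := Ioi 0)
    have h0 : 0 ≤ derivWithin (deriv fun R => profile m R ^ a) (Ioi 0) R :=
      hmono.derivWithin_nonneg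
    rw [h2.derivWithin (isOpen_Ioi.uniqueDiffWithinAt hR)] at h0
    linarith [nonneg_of_mul_nonneg_right h0 (hpos R hR)]
  · intro h
    refine convexOn_of_deriv2_nonneg (convex_Ioi 0) hdiff.continuousOn ?_ ?_ ?_
    · rwa [interior_Ioi]
    · rw [interior_Ioi]
      exact fun R hR => (deriv_deriv_profile_rpow m a hR).differentiableAt.differentiableWithinAt
    · rw [interior_Ioi]
      intro R hR
      simp only [Function.iterate_succ, Function.iterate_zero, Function.comp_apply, id]
      rw [(deriv_deriv_profile_rpow m a hR).deriv]
      refine mul_nonneg (hpos R hR).le ?_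
      linarith [(alpha_isLUB m).1 (mem_image_of_mem _ hR)]

/-! ### Integration in polar coordinates -/

/-- Integration in polar coordinates with respect to a Haar measure. -/
lemma integral_polar {E : Type*} [NormedAddCommGroup E] [NormedSpace ℝ E] [MeasurableSpace E]
    [Nontrivial E] [FiniteDimensional ℝ E] [BorelSpace E] (μ : Measure E) [μ.IsAddHaarMeasure]
    {f : E → ℝ} (hf : Integrable f μ) :
    ∫ x, f x ∂μ = ∫ θ : Metric.sphere (0 : E) 1,
      (∫ r in Ioi (0 : ℝ), r ^ (Module.finrank ℝ E - 1) * f (r • (θ : E))) ∂μ.toSphere := by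
  have hmp := μ.measurePreserving_homeomorphUnitSphereProd
  have hemb := (homeomorphUnitSphereProd E).measurableEmbedding
  set F : Metric.sphere (0 : E) 1 × Ioi (0 : ℝ) → ℝ := fun y => f (y.2.1 • y.1.1) with hF
  have hFf : ∀ x : ({0}ᶜ : Set E), F (homeomorphUnitSphereProd E x) = f x := fun x => by
    have := homeomorphUnitSphereProd_symm_apply_coe E (homeomorphUnitSphereProd E x)
    rw [Homeomorph.symm_apply_apply] at this
    rw [hF]
    simp only [← this]
  have hint : Integrable F (μ.toSphere.prod (.volumeIoiPow (Module.finrank ℝ E - 1))) := by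
    rw [← hmp.integrable_comp_emb hemb]
    have h1 : IntegrableOn f ({0}ᶜ) μ := hf.integrableOn
    rw [integrableOn_iff_comap_subtypeVal (measurableSet_singleton _).compl] at h1
    exact h1.congr (Eventually.of_forall fun x => (hFf x).symm)
  -- The polar homeomorphism lives off the origin, which is a null set.
  calc ∫ x, f x ∂μ = ∫ x : ({0}ᶜ : Set E), f x ∂(μ.comap (↑)) := by
        rw [integral_subtype_comap (measurableSet_singleton _).compl, restrict_compl_singleton]
    _ = ∫ y, F y ∂(μ.toSphere.prod (.volumeIoiPow (Module.finrank ℝ E - 1))) := by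
        rw [← hmp.integral_comp hemb]
        exact integral_congr_ae (Eventually.of_forall fun x => (hFf x).symm)
    _ = _ := by
        rw [integral_prod _ hint]
        refine integral_congr_ae (Eventually.of_forall fun θ => ?_)
        simp only [Measure.volumeIoiPow, ENNReal.ofReal]
        rw [integral_withDensity_eq_integral_smul
          ((measurable_subtype_coe.pow_const _).real_toNNReal),
          integral_subtype_comap measurableSet_Ioi
            fun a : ℝ => Real.toNNReal (a ^ (Module.finrank ℝ E - 1)) • f (a • (θ : E))]
        refine setIntegral_congr_fun measurableSet_Ioi fun r hr => ?_
        simp only [NNReal.smul_def, smul_eq_mul]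
        rw [Real.coe_toNNReal _ (pow_nonneg (le_of_lt hr) _)]

/-! ### Integrals with respect to the Gaussian measure -/

/-- The normalizing constant `(2π)^(-n/2)` of the Gaussian measure. -/
def gaussConst (n : ℕ) : ℝ := (2 * Real.pi) ^ (-(n : ℝ) / 2)

lemma gaussConst_pos (n : ℕ) : 0 < gaussConst n := by unfold gaussConst; positivity

/-- The area of the unit sphere of `ℝ^(m + 1)`, times the constant of the Gaussian measure. -/
def areaConst (m : ℕ) : ℝ :=
  gaussConst (m + 1) * ((m + 1) * volume.real (Metric.ball (0 : Rn (m + 1)) 1))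

lemma areaConst_pos (m : ℕ) : 0 < areaConst m := by
  have h : 0 < volume.real (Metric.ball (0 : Rn (m + 1)) 1) :=
    ENNReal.toReal_pos (Metric.measure_ball_pos _ _ one_pos).ne' measure_ball_lt_top.ne
  have := gaussConst_pos (m + 1)
  unfold areaConst
  positivity

instance isLocallyFiniteMeasure_gauss (n : ℕ) : IsLocallyFiniteMeasure (gauss n) :=
  IsLocallyFiniteMeasure.withDensity_ofReal (by fun_prop)

instance isFiniteMeasure_gauss_ball (n : ℕ) (R : ℝ) :
    IsFiniteMeasure ((gauss n).restrict (Metric.ball (0 : Rn n) R)) :=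
  ⟨by simpa using measure_ball_lt_top⟩

lemma setIntegral_gauss {n : ℕ} {s : Set (Rn n)} (hs : MeasurableSet s) (g : Rn n → ℝ) :
    ∫ x in s, g x ∂(gauss n) = gaussConst n * ∫ x in s, Real.exp (-‖x‖ ^ 2 / 2) * g x := by
  unfold gauss
  rw [setIntegral_withDensity_eq_setIntegral_toReal_smul (by fun_prop) (by simp) _ hs,
    ← integral_const_mul]
  refine integral_congr_ae (Eventually.of_forall fun x => ?_)
  have := gaussConst_pos n
  simp only [smul_eq_mul]
  rw [ENNReal.toReal_ofReal (by positivity), gaussConst, mul_assoc]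

lemma setIntegral_gauss_radial (m : ℕ) {R : ℝ} (hR : 0 ≤ R) (f : ℝ → ℝ) :
    ∫ x in Metric.ball (0 : Rn (m + 1)) R, f ‖x‖ ∂(gauss (m + 1)) =
      areaConst m * ∫ r in (0 : ℝ)..R, dens m r * f r := by
  rw [setIntegral_gauss measurableSet_ball, ← integral_indicator measurableSet_ball]
  have h1 : (Metric.ball (0 : Rn (m + 1)) R).indicator
      (fun x => Real.exp (-‖x‖ ^ 2 / 2) * f ‖x‖) =
      fun x => (Iio R).indicator (fun r => Real.exp (-r ^ 2 / 2) * f r) ‖x‖ := by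
    ext x
    simp [indicator]
  rw [h1, integral_fun_norm_addHaar, finrank_euclideanSpace_fin, Nat.add_sub_cancel]
  have h2 : ∫ y in Ioi (0 : ℝ), y ^ m • (Iio R).indicator (fun r => Real.exp (-r ^ 2 / 2) * f r) y =
      ∫ r in (0 : ℝ)..R, dens m r * f r := by
    rw [intervalIntegral.integral_of_le hR, integral_Ioc_eq_integral_Ioo, ← Ioi_inter_Iio,
      ← setIntegral_indicator measurableSet_Iio]
    refine integral_congr_ae (Eventually.of_forall fun y => ?_)
    by_cases hy : y < R <;> simp [indicator, hy, dens, mul_assoc]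
  rw [h2]
  simp only [nsmul_eq_mul, smul_eq_mul, areaConst]
  push_cast
  ring

/-! ### Test functions -/

namespace IsTest

variable {n : ℕ} {Ω : Set (Rn n)} {φ : Rn n → ℝ}

lemma continuous (h : IsTest Ω φ) : Continuous φ := h.1.continuous

lemma differentiable (h : IsTest Ω φ) : Differentiable ℝ φ := h.1.differentiable (by simp)

lemma continuous_fderiv (h : IsTest Ω φ) : Continuous (fderiv ℝ φ) :=
  h.1.continuous_fderiv (by simp)

lemma continuous_gradient (h : IsTest Ω φ) : Continuous (gradient φ) :=
  (InnerProductSpace.toDual ℝ (Rn n)).symm.continuous.comp h.continuous_fderiv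

lemma hasCompactSupport_gradient (h : IsTest Ω φ) : HasCompactSupport (gradient φ) :=
  (h.2.1.fderiv ℝ).comp_left (g := (InnerProductSpace.toDual ℝ (Rn n)).symm) (map_zero _)

end IsTest

lemma norm_gradient {n : ℕ} (φ : Rn n → ℝ) (x : Rn n) : ‖gradient φ x‖ = ‖fderiv ℝ φ x‖ :=
  LinearIsometryEquiv.norm_map _ _

lemma inner_gradient {n : ℕ} (φ : Rn n → ℝ) (x v : Rn n) :
    inner ℝ (gradient φ x) v = fderiv ℝ φ x v :=
  InnerProductSpace.toDual_symm_apply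

lemma IsTest.memWZero {n : ℕ} {Ω : Set (Rn n)} {φ : Rn n → ℝ} (h : IsTest Ω φ) :
    MemWZero Ω φ (gradient φ) := by
  refine ⟨⟨?_, ?_, ?_⟩, fun _ => φ, fun _ => h, by simp, by simp⟩
  · exact (h.continuous.memLp_of_hasCompactSupport h.2.1).restrict _
  · exact (h.continuous_gradient.memLp_of_hasCompactSupport h.hasCompactSupport_gradient).restrict _
  · intro ψ hψ v
    have hz : ∀ x ∉ Ω, ψ x = 0 := fun x hx => image_eq_zero_of_notMem_tsupport fun h => hx (hψ.2.2 h)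
    have hz' : ∀ x ∉ Ω, φ x = 0 := fun x hx => image_eq_zero_of_notMem_tsupport fun h' => hx (h.2.2 h')
    -- Both integrands vanish off Ω, so integration by parts can be done on the whole space.
    rw [setIntegral_eq_integral_of_forall_compl_eq_zero (fun x hx => by simp [hz' x hx]),
      setIntegral_eq_integral_of_forall_compl_eq_zero (fun x hx => by simp [hz x hx])]
    simp only [inner_gradient]
    have hc := h.continuous_fderiv
    have hc' := hψ.continuous_fderiv
    have hd := h.continuous
    have hd' := hψ.continuous
    refine integral_mul_fderiv_eq_neg_fderiv_mul_of_integrable ?_ ?_ ?_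
      (fun x _ => h.differentiable x) (fun x _ => hψ.differentiable x)
    · exact Continuous.integrable_of_hasCompactSupport (by fun_prop) hψ.2.1.mul_left
    · exact Continuous.integrable_of_hasCompactSupport (by fun_prop) h.2.1.mul_right
    · exact Continuous.integrable_of_hasCompactSupport (by fun_prop) h.2.1.mul_right

/-- Integration by parts on a ray. -/
lemma integral_ray (m : ℕ) {φ : Rn (m + 1) → ℝ} (hφ : ContDiff ℝ ∞ φ) (hc : HasCompactSupport φ)
    {θ : Rn (m + 1)} (hθ : ‖θ‖ = 1) :
    ∫ r in Ioi (0 : ℝ), r ^ m * (Real.exp (-‖r • θ‖ ^ 2 / 2) * φ (r • θ)) =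
      ∫ r in Ioi (0 : ℝ), r ^ m * -(fderiv ℝ φ (r • θ) (r • θ) *
        (radial (m + 1) ‖r • θ‖ / ‖r • θ‖ ^ (m + 1))) := by
  have hcd : Continuous (fderiv ℝ φ) := hφ.continuous_fderiv (by simp)
  have hcφ := hφ.continuous
  have hemb : Topology.IsClosedEmbedding fun r : ℝ => r • θ :=
    isClosedEmbedding_smul_left (norm_ne_zero_iff.1 (by simp [hθ]))
  have hs : HasCompactSupport fun r : ℝ => φ (r • θ) := hc.comp_isClosedEmbedding hemb
  have hs' : HasCompactSupport fun r : ℝ => fderiv ℝ φ (r • θ) :=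
    (hc.fderiv ℝ).comp_isClosedEmbedding hemb
  have hu : ∀ r : ℝ, HasDerivAt (fun r : ℝ => φ (r • θ)) (fderiv ℝ φ (r • θ) θ) r := fun r => by
    have h1 : HasDerivAt (fun r : ℝ => r • θ) θ r := by
      simpa using (hasDerivAt_id r).smul_const θ
    exact ((hφ.differentiable (by simp)) (r • θ)).hasFDerivAt.comp_hasDerivAt r h1
  have hdens := continuous_dens m
  have hrad := continuous_radial m
  -- The boundary term at 0 vanishes because I(0) = 0, the one at infinity because φ has compact
  -- support.
  have h := integral_Ioi_mul_deriv_eq_deriv_mul (a := 0) (a' := 0) (b' := 0)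
    (fun r _ => hu r) (fun r _ => hasDerivAt_radial m r) ?_ ?_ ?_ ?_
  · rw [sub_zero, zero_sub, ← integral_neg] at h
    refine Eq.trans ?_ (h.trans ?_)
    · refine setIntegral_congr_fun measurableSet_Ioi fun r hr => ?_
      simp only [norm_smul, hθ, Real.norm_eq_abs, mul_one, sq_abs, dens]
      ring
    -- Differentiating along rθ instead of θ costs a factor r, absorbed by the power m + 1; the
    -- integrand is then a function of the point rθ alone.
    · refine setIntegral_congr_fun measurableSet_Ioi fun r hr => ?_
      have hr : 0 < r := hr
      simp only [norm_smul, hθ, Real.norm_eq_abs, mul_one, abs_of_pos hr, map_smul, smul_eq_mul]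
      field_simp
      ring
  · exact (Continuous.integrable_of_hasCompactSupport (by fun_prop) hs.mul_right).integrableOn
  · refine (Continuous.integrable_of_hasCompactSupport (by fun_prop) ?_).integrableOn
    refine HasCompactSupport.mul_right ?_
    exact hs'.comp_left (g := fun L : Rn (m + 1) →L[ℝ] ℝ => L θ) (by simp)
  · have : Continuous ((fun r : ℝ => φ (r • θ)) * radial (m + 1)) := by fun_prop
    simpa [radial_zero] using (this.tendsto 0).mono_left (nhdsWithin_le_nhds (s := Ioi 0))
  · have h0 : HasCompactSupport ((fun r : ℝ => φ (r • θ)) * radial (m + 1)) := hs.mul_right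
    exact h0.is_zero_at_infty.mono_left atTop_le_cocompact

lemma radial_div_pow_le (m : ℕ) {r : ℝ} (hr : 0 ≤ r) : radial (m + 1) r / r ^ (m + 1) ≤ 1 := by
  refine div_le_one_of_le₀ ((radial_le m hr).trans ?_) (by positivity)
  exact div_le_self (by positivity) (by linarith [(Nat.cast_nonneg m : (0 : ℝ) ≤ m)])

/-- Divergence theorem for the field x I(|x|)/|x|^n, whose divergence is exp(-|x|²/2). -/
lemma integral_exp_mul (m : ℕ) {φ : Rn (m + 1) → ℝ} (hφ : ContDiff ℝ ∞ φ)
    (hc : HasCompactSupport φ) :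
    ∫ x, Real.exp (-‖x‖ ^ 2 / 2) * φ x =
      ∫ x, -(fderiv ℝ φ x x * (radial (m + 1) ‖x‖ / ‖x‖ ^ (m + 1))) := by
  have hcd : Continuous (fderiv ℝ φ) := hφ.continuous_fderiv (by simp)
  have hcφ := hφ.continuous
  have hrad := continuous_radial m
  have h1 : Integrable fun x => Real.exp (-‖x‖ ^ 2 / 2) * φ x :=
    Continuous.integrable_of_hasCompactSupport (by fun_prop) hc.mul_left
  have h2 : Integrable fun x : Rn (m + 1) =>
      -(fderiv ℝ φ x x * (radial (m + 1) ‖x‖ / ‖x‖ ^ (m + 1))) := by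
    have h3 : Integrable fun x : Rn (m + 1) => fderiv ℝ φ x x := by
      refine Continuous.integrable_of_hasCompactSupport (by fun_prop) ?_
      refine (hc.fderiv ℝ).mono fun x hx => ?_
      simp only [Function.mem_support] at hx ⊢
      rintro h; simp [h] at hx
    refine (h3.mul_bdd (c := 1) ?_ (Eventually.of_forall fun x => ?_)).neg
    · exact ((hrad.comp continuous_norm).measurable.div
        (continuous_norm.pow _).measurable).aestronglyMeasurable
    · rw [Real.norm_of_nonneg (div_nonneg (radial_nonneg m (norm_nonneg x)) (by positivity))]
      exact radial_div_pow_le m (norm_nonneg x)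
  rw [integral_polar _ h1, integral_polar _ h2]
  simp only [finrank_euclideanSpace_fin, Nat.add_sub_cancel]
  refine integral_congr_ae (Eventually.of_forall fun θ => ?_)
  exact integral_ray m hφ hc (by simp)

/-! ### The upper bound -/

lemma radial_div_dens_le (m : ℕ) {r R : ℝ} (hr : 0 ≤ r) (hrR : r ≤ R) :
    radial (m + 1) r / dens m r ≤ R * Real.exp (R ^ 2 / 2) := by
  rcases hr.eq_or_lt with rfl | hr'
  · simp only [radial_zero, zero_div]; positivity
  rw [div_le_iff₀ (dens_pos m hr')]
  calc radial (m + 1) r ≤ r ^ (m + 1) / (m + 1) := radial_le m hr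
    _ ≤ r ^ (m + 1) := div_le_self (by positivity) (by linarith [(Nat.cast_nonneg m : (0 : ℝ) ≤ m)])
    _ = r * Real.exp (r ^ 2 / 2) * dens m r := by
        have : Real.exp (r ^ 2 / 2) * Real.exp (-r ^ 2 / 2) = 1 := by
          rw [← Real.exp_add]; ring_nf; simp
        unfold dens
        linear_combination (-(r * r ^ m)) * this
    _ ≤ R * Real.exp (R ^ 2 / 2) * dens m r := by
        have := dens_pos m hr'
        have := hr.trans hrR
        gcongr

lemma dens_mul_sq (m : ℕ) {r : ℝ} (hr : 0 ≤ r) :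
    dens m r * (radial (m + 1) r / dens m r) ^ 2 = radial (m + 1) r ^ 2 / dens m r := by
  rcases hr.eq_or_lt with rfl | hr'
  · simp [radial_zero]
  have := (dens_pos m hr').ne'
  field_simp

/-- I/p is the length of the gradient of the torsion function; its energy is the constant in the
upper bound. -/
lemma integral_sq_radial_div_dens (m : ℕ) {R : ℝ} (hR : 0 ≤ R) :
    ∫ x in Metric.ball (0 : Rn (m + 1)) R, (radial (m + 1) ‖x‖ / dens m ‖x‖) ^ 2 ∂(gauss (m + 1)) =
      areaConst m * profile m R := by
  rw [setIntegral_gauss_radial m hR fun r => (radial (m + 1) r / dens m r) ^ 2, profile]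
  congr 1
  refine intervalIntegral.integral_congr fun r hr => ?_
  rw [uIcc_of_le hR] at hr
  exact dens_mul_sq m hr.1

/-- The divergence identity bounds the integral of φ by that of |∇φ| I/p, and Cauchy–Schwarz
separates the two factors. -/
lemma IsTest.sq_integral_le (m : ℕ) {R : ℝ} (hR : 0 ≤ R) {φ : Rn (m + 1) → ℝ}
    (h : IsTest (Metric.ball 0 R) φ) :
    (∫ x in Metric.ball (0 : Rn (m + 1)) R, φ x ∂(gauss (m + 1))) ^ 2 ≤
      areaConst m * profile m R *
        ∫ x in Metric.ball (0 : Rn (m + 1)) R, ‖gradient φ x‖ ^ 2 ∂(gauss (m + 1)) := by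
  set B := Metric.ball (0 : Rn (m + 1)) R with hB
  set q : ℝ → ℝ := fun r => radial (m + 1) r / dens m r with hq
  have hz : ∀ x ∉ B, φ x = 0 := fun x hx => image_eq_zero_of_notMem_tsupport fun h' => hx (h.2.2 h')
  have hz' : ∀ x ∉ B, fderiv ℝ φ x = 0 := fun x hx =>
    image_eq_zero_of_notMem_tsupport fun h' => hx (h.2.2 (tsupport_fderiv_subset ℝ h'))
  have hq0 : ∀ r, 0 ≤ r → 0 ≤ q r := fun r hr =>
    div_nonneg (radial_nonneg m hr) (by unfold dens; positivity)
  have hid : ∫ x in B, φ x ∂(gauss (m + 1)) =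
      ∫ x in B, -(fderiv ℝ φ x x * (q ‖x‖ / ‖x‖)) ∂(gauss (m + 1)) := by
    rw [setIntegral_gauss measurableSet_ball, setIntegral_gauss measurableSet_ball,
      setIntegral_eq_integral_of_forall_compl_eq_zero (fun x hx => by simp [hz x hx]),
      setIntegral_eq_integral_of_forall_compl_eq_zero (fun x hx => by simp [hz' x hx]),
      integral_exp_mul m h.1 h.2.1]
    congr 1
    refine integral_congr_ae (Eventually.of_forall fun x => ?_)
    rcases eq_or_ne x 0 with rfl | hx
    · simp
    · have hx' := (norm_pos_iff.2 hx).ne'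
      simp only [hq, dens]
      field_simp
      ring
  have hqm : AEStronglyMeasurable (fun x : Rn (m + 1) => q ‖x‖) ((gauss (m + 1)).restrict B) :=
    (((continuous_radial m).comp continuous_norm).measurable.div
      ((continuous_dens m).comp continuous_norm).measurable).aestronglyMeasurable
  have hq2 : MemLp (fun x : Rn (m + 1) => q ‖x‖) (ENNReal.ofReal 2)
      ((gauss (m + 1)).restrict B) := by
    refine MemLp.of_bound hqm (R * Real.exp (R ^ 2 / 2)) ?_
    filter_upwards [ae_restrict_mem measurableSet_ball] with x hx
    rw [Real.norm_of_nonneg (hq0 _ (norm_nonneg x))]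
    exact radial_div_dens_le m (norm_nonneg x) (le_of_lt (by simpa [hB] using hx))
  have hg2 : MemLp (fun x : Rn (m + 1) => ‖gradient φ x‖) (ENNReal.ofReal 2)
      ((gauss (m + 1)).restrict B) :=
    ((h.continuous_gradient.memLp_of_hasCompactSupport h.hasCompactSupport_gradient).restrict _).norm
  have hle : |∫ x in B, φ x ∂(gauss (m + 1))| ≤
      ∫ x in B, ‖gradient φ x‖ * q ‖x‖ ∂(gauss (m + 1)) := by
    rw [hid, ← Real.norm_eq_abs]
    refine norm_integral_le_of_norm_le ?_ (Eventually.of_forall fun x => ?_)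
    · have : ENNReal.HolderTriple (ENNReal.ofReal 2) (ENNReal.ofReal 2) 1 := by
        rw [ENNReal.ofReal_ofNat]; infer_instance
      exact hg2.integrable_mul hq2
    · rw [norm_neg, norm_mul, norm_gradient, norm_div, norm_norm,
        Real.norm_of_nonneg (hq0 _ (norm_nonneg x))]
      rcases eq_or_ne x 0 with rfl | hx
      · simp [hq, radial_zero]
      · have hx' := norm_pos_iff.2 hx
        calc _ ≤ ‖fderiv ℝ φ x‖ * ‖x‖ * (q ‖x‖ / ‖x‖) :=
              mul_le_mul_of_nonneg_right ((fderiv ℝ φ x).le_opNorm x)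
                (div_nonneg (hq0 _ (norm_nonneg x)) (norm_nonneg x))
          _ = _ := by field_simp
  have hCS := integral_mul_le_Lp_mul_Lq_of_nonneg (μ := (gauss (m + 1)).restrict B)
    Real.HolderConjugate.two_two (Eventually.of_forall fun x => norm_nonneg (gradient φ x))
    (Eventually.of_forall fun x => hq0 ‖x‖ (norm_nonneg x)) hg2 hq2
  have h3 := hle.trans hCS
  simp only [Real.rpow_ofNat, ← Real.sqrt_eq_rpow] at h3
  rw [integral_sq_radial_div_dens m hR] at h3
  have hC : 0 ≤ areaConst m * profile m R := by
    rw [← integral_sq_radial_div_dens m hR]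
    exact integral_nonneg fun x => sq_nonneg _
  have hG : 0 ≤ ∫ x in B, ‖gradient φ x‖ ^ 2 ∂(gauss (m + 1)) :=
    integral_nonneg fun x => sq_nonneg _
  calc _ = |∫ x in B, φ x ∂(gauss (m + 1))| ^ 2 := (sq_abs _).symm
    _ ≤ _ := pow_le_pow_left₀ (abs_nonneg _) h3 2
    _ = _ := by rw [mul_pow, Real.sq_sqrt hG, Real.sq_sqrt hC, mul_comm]

lemma toReal_eLpNorm_sq {α F : Type*} [MeasurableSpace α] [NormedAddCommGroup F] {μ : Measure α}
    {f : α → F} (hf : MemLp f 2 μ) : (eLpNorm f 2 μ).toReal ^ 2 = ∫ x, ‖f x‖ ^ 2 ∂μ := by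
  have h0 : 0 ≤ ∫ x, ‖f x‖ ^ 2 ∂μ := integral_nonneg fun x => sq_nonneg _
  rw [hf.eLpNorm_eq_integral_rpow_norm two_ne_zero ENNReal.ofNat_ne_top]
  simp only [ENNReal.toReal_ofNat, Real.rpow_ofNat]
  rw [ENNReal.toReal_ofReal (by positivity), ← Real.rpow_natCast, ← Real.rpow_mul h0]
  norm_num

/-- The inequality passes to the closure: the Gaussian measure of the ball is finite, so L²
convergence gives convergence of the integrals, and L² convergence of gradients gives convergence of
the energies. -/
lemma MemWZero.sq_integral_le (m : ℕ) {R : ℝ} (hR : 0 ≤ R) {w : Rn (m + 1) → ℝ}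
    {g : Rn (m + 1) → Rn (m + 1)} (h : MemWZero (Metric.ball 0 R) w g) :
    (∫ x in Metric.ball (0 : Rn (m + 1)) R, w x ∂(gauss (m + 1))) ^ 2 ≤
      areaConst m * profile m R *
        ∫ x in Metric.ball (0 : Rn (m + 1)) R, ‖g x‖ ^ 2 ∂(gauss (m + 1)) := by
  obtain ⟨⟨hw, hg, -⟩, φ, hφ, hφw, hφg⟩ := h
  set μ := (gauss (m + 1)).restrict (Metric.ball (0 : Rn (m + 1)) R) with hμ
  have hgφ : ∀ k, MemLp (gradient (φ k)) 2 μ := fun k =>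
    ((hφ k).continuous_gradient.memLp_of_hasCompactSupport (hφ k).hasCompactSupport_gradient).restrict _
  have hwφ : ∀ k, MemLp (φ k) 2 μ := fun k =>
    ((hφ k).continuous.memLp_of_hasCompactSupport (hφ k).2.1).restrict _
  have h1 : Tendsto (fun k => ∫ x, φ k x ∂μ) atTop (𝓝 (∫ x, w x ∂μ)) := by
    refine tendsto_integral_of_L1' w hw.1
      (Eventually.of_forall fun k => (hwφ k).integrable one_le_two) ?_
    have h0 : Tendsto (fun k => eLpNorm (fun x => φ k x - w x) 2 μ *
        μ univ ^ (1 / (1 : ENNReal).toReal - 1 / (2 : ENNReal).toReal)) atTop (𝓝 0) := by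
      have := ENNReal.Tendsto.mul_const (b := μ univ ^ (1 / (1 : ENNReal).toReal -
        1 / (2 : ENNReal).toReal)) hφw (Or.inr ?_)
      · simpa using this
      · exact ENNReal.rpow_ne_top_of_nonneg (by norm_num) (measure_ne_top _ _)
    refine tendsto_of_tendsto_of_tendsto_of_le_of_le tendsto_const_nhds h0 (fun _ => zero_le)
      fun k => ?_
    exact eLpNorm_le_eLpNorm_mul_rpow_measure_univ one_le_two ((hwφ k).sub hw).1
  have h2 : Tendsto (fun k => ∫ x, ‖gradient (φ k) x‖ ^ 2 ∂μ) atTop (𝓝 (∫ x, ‖g x‖ ^ 2 ∂μ)) := by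
    have := ((Lp.tendsto_Lp_iff_tendsto_eLpNorm'' _ hgφ g hg).2 hφg).norm.pow 2
    simpa only [Lp.norm_toLp, toReal_eLpNorm_sq, hgφ, hg] using this
  exact le_of_tendsto_of_tendsto' (h1.pow 2) (h2.const_mul _) fun k => (hφ k).sq_integral_le m hR

lemma torsionQuotients_le (m : ℕ) {R q : ℝ} (hR : 0 ≤ R)
    (hq : q ∈ torsionQuotients (Metric.ball (0 : Rn (m + 1)) R)) :
    q ≤ areaConst m * profile m R := by
  obtain ⟨w, g, h, hpos, rfl⟩ := hq
  rw [div_le_iff₀ hpos]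
  exact h.sq_integral_le m hR

/-! ### The lower bound -/

/-- A radial function which is constant near the origin and vanishes near the boundary of the
ball is a test function. -/
lemma isTest_comp_norm {n : ℕ} {F : ℝ → ℝ} {ε ρ R : ℝ} (hF : ContDiff ℝ ∞ F) (hε : 0 < ε)
    (hρ : ρ < R) (hF0 : ∀ r < ε, F r = F 0) (hFρ : ∀ r, ρ ≤ r → F r = 0) :
    IsTest (Metric.ball (0 : Rn n) R) fun x => F ‖x‖ := by
  have hsub : tsupport (fun x : Rn n => F ‖x‖) ⊆ Metric.closedBall 0 ρ := by
    refine closure_minimal (fun x hx => ?_) Metric.isClosed_closedBall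
    rw [mem_closedBall_zero_iff]
    by_contra! h
    exact hx (hFρ _ h.le)
  refine ⟨?_, ?_, hsub.trans (Metric.closedBall_subset_ball hρ)⟩
  · rw [contDiff_iff_contDiffAt]
    intro x
    rcases eq_or_ne x 0 with rfl | hx
    · refine (contDiffAt_const (c := F 0)).congr_of_eventuallyEq ?_
      filter_upwards [Metric.ball_mem_nhds (0 : Rn n) hε] with y hy
      exact hF0 _ (by simpa using hy)
    · exact hF.contDiffAt.comp x (contDiffAt_norm ℝ hx)
  · exact (isCompact_closedBall (0 : Rn n) ρ).of_isClosed_subset (isClosed_tsupport _) hsub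

lemma norm_gradient_comp_norm (m : ℕ) {F : ℝ → ℝ} {s : ℝ} {x : Rn (m + 1)} (hx : x ≠ 0)
    (hF : HasDerivAt F s ‖x‖) : ‖gradient (fun x => F ‖x‖) x‖ = |s| := by
  have hd : DifferentiableAt ℝ (fun x : Rn (m + 1) => ‖x‖) x :=
    (contDiffAt_norm ℝ hx (n := 1)).differentiableAt one_ne_zero
  have h : HasFDerivAt (fun x : Rn (m + 1) => F ‖x‖)
      (s • fderiv ℝ (fun x : Rn (m + 1) => ‖x‖) x) x := hF.comp_hasFDerivAt x hd.hasFDerivAt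
  rw [norm_gradient, h.fderiv, norm_smul, norm_fderiv_norm hd, mul_one, Real.norm_eq_abs]

lemma exists_cutoff {a b R : ℝ} (ha : 0 < a) (hab : a < b) (hb : b < R) :
    ∃ (χ : ℝ → ℝ) (ε ρ : ℝ), ContDiff ℝ ∞ χ ∧ 0 < ε ∧ 0 < ρ ∧ ρ < R ∧ (∀ r, 0 ≤ χ r) ∧
      (∀ r, χ r ≤ 1) ∧
      (∀ r ∈ Icc a b, χ r = 1) ∧ (∀ r < ε, χ r = 0) ∧ ∀ r, ρ ≤ r → χ r = 0 := by
  -- The bump is centred at the midpoint of [a, b]; δ leaves room on both sides before 0 and R.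
  set δ := min (a / 2) ((R - b) / 2) with hδ
  have hδ0 : 0 < δ := lt_min (by linarith) (by linarith)
  have hδ1 : δ ≤ a / 2 := min_le_left _ _
  have hδ2 : δ ≤ (R - b) / 2 := min_le_right _ _
  let f : ContDiffBump ((a + b) / 2) := ⟨(b - a) / 2, (b - a) / 2 + δ, by linarith, by linarith⟩
  refine ⟨f, a - δ, b + δ, f.contDiff, by linarith, by linarith, by linarith, f.nonneg',
    fun _ => f.le_one, fun r hr => ?_, fun r hr => ?_, fun r hr => ?_⟩
  · refine f.one_of_mem_closedBall ?_
    change dist r ((a + b) / 2) ≤ (b - a) / 2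
    rw [Real.dist_eq, abs_le]
    constructor <;> linarith [hr.1, hr.2]
  · refine f.zero_of_le_dist ?_
    change (b - a) / 2 + δ ≤ dist r ((a + b) / 2)
    rw [Real.dist_eq, le_abs]
    right; linarith
  · refine f.zero_of_le_dist ?_
    change (b - a) / 2 + δ ≤ dist r ((a + b) / 2)
    rw [Real.dist_eq, le_abs]
    left; linarith

lemma profile_lt_profile (m : ℕ) {a b : ℝ} (ha : 0 < a) (hab : a < b) :
    profile m a < profile m b := by
  have h : profile m b - profile m a = ∫ t in a..b, radial (m + 1) t ^ 2 / dens m t :=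
    intervalIntegral.integral_interval_sub_left
      (intervalIntegrable_integrand m le_rfl (ha.le.trans hab.le))
      (intervalIntegrable_integrand m le_rfl ha.le)
  have : 0 < ∫ t in a..b, radial (m + 1) t ^ 2 / dens m t := by
    refine intervalIntegral.intervalIntegral_pos_of_pos_on
      (intervalIntegrable_integrand m ha.le (ha.le.trans hab.le)) (fun t ht => ?_) hab
    exact div_pos (pow_pos (radial_pos m (ha.trans ht.1)) 2) (dens_pos m (ha.trans ht.1))
  linarith

/-- The slope of the torsion function is cut off, not the function itself. With F' = -χ I/p the
integral is cX and the energy is cY, where Y ≤ X because 0 ≤ χ ≤ 1; the quotient cX²/Y is then at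
least cX ≥ cY ≥ c(G(b) - G(a)). -/
lemma exists_quotient (m : ℕ) {a b R : ℝ} (ha : 0 < a) (hab : a < b) (hb : b < R) :
    ∃ q ∈ torsionQuotients (Metric.ball (0 : Rn (m + 1)) R),
      areaConst m * (profile m b - profile m a) ≤ q := by
  obtain ⟨χ, ε, ρ, hχ, hε, hρ0, hρ, h0, h1, hone, hzero, hzero'⟩ := exists_cutoff ha hab hb
  have hR : 0 < R := hρ0.trans hρ
  set s : ℝ → ℝ := fun r => χ r * (radial (m + 1) r / dens m r) with hs
  have hs0 : ∀ r < ε, s r = 0 := fun r hr => by simp [hs, hzero r hr]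
  have hs1 : ∀ r, ρ ≤ r → s r = 0 := fun r hr => by simp [hs, hzero' r hr]
  have hsm : ContDiff ℝ ∞ s := by
    rw [contDiff_iff_contDiffAt]
    intro r
    rcases lt_or_ge r ε with hr | hr
    -- p vanishes at 0 when m ≥ 1, so smoothness there comes from χ being zero below ε.
    · refine (contDiffAt_const (c := (0 : ℝ))).congr_of_eventuallyEq ?_
      filter_upwards [Iio_mem_nhds hr] with t ht using hs0 t ht
    · exact hχ.contDiffAt.mul ((contDiff_radial m).contDiffAt.div (contDiff_dens m).contDiffAt
        (dens_pos m (hε.trans_le hr)).ne')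
  have hsc := hsm.continuous
  have hsi : ∀ a b, IntervalIntegrable s volume a b := fun a b => hsc.intervalIntegrable a b
  set F : ℝ → ℝ := fun r => ∫ t in r..R, s t with hF
  have hFd : ∀ r, HasDerivAt F (-s r) r := fun r =>
    intervalIntegral.integral_hasDerivAt_left (hsi r R)
      (hsc.stronglyMeasurableAtFilter _ _) hsc.continuousAt
  have hFs : ContDiff ℝ ∞ F := by
    rw [contDiff_infty_iff_deriv]
    refine ⟨fun r => (hFd r).differentiableAt, ?_⟩
    rw [show deriv F = fun r => -s r from funext fun r => (hFd r).deriv]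
    exact hsm.neg
  have hF0 : ∀ r < ε, F r = F 0 := fun r hr => by
    simp only [hF]
    rw [← intervalIntegral.integral_add_adjacent_intervals (hsi r 0) (hsi 0 R), add_eq_right]
    refine intervalIntegral.integral_zero_ae (Eventually.of_forall fun t ht => hs0 t ?_)
    exact (uIoc_subset_uIcc ht).2.trans_lt (max_lt hr hε)
  have hFρ : ∀ r, ρ ≤ r → F r = 0 := fun r hr => by
    refine intervalIntegral.integral_zero_ae (Eventually.of_forall fun t ht => hs1 t ?_)
    exact (le_min hr hρ.le).trans (uIoc_subset_uIcc ht).1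
  have htest : IsTest (Metric.ball (0 : Rn (m + 1)) R) fun x => F ‖x‖ :=
    isTest_comp_norm hFs hε hρ hF0 hFρ
  set X := ∫ r in (0 : ℝ)..R, χ r * (radial (m + 1) r ^ 2 / dens m r) with hX
  set Y := ∫ r in (0 : ℝ)..R, χ r ^ 2 * (radial (m + 1) r ^ 2 / dens m r) with hY
  have hint := intervalIntegrable_integrand m le_rfl hR.le
  have hintX : IntervalIntegrable (fun r => χ r * (radial (m + 1) r ^ 2 / dens m r)) volume 0 R :=
    hint.continuousOn_mul hχ.continuous.continuousOn
  have hintY : IntervalIntegrable (fun r => χ r ^ 2 * (radial (m + 1) r ^ 2 / dens m r)) volume 0 R :=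
    hint.continuousOn_mul (hχ.continuous.pow 2).continuousOn
  have hIF : ∫ x in Metric.ball (0 : Rn (m + 1)) R, F ‖x‖ ∂(gauss (m + 1)) = areaConst m * X := by
    rw [setIntegral_gauss_radial m hR.le F]
    congr 1
    -- No boundary terms: F(R) = 0 and I(0) = 0.
    have hparts := intervalIntegral.integral_mul_deriv_eq_deriv_mul (a := 0) (b := R)
      (fun r _ => hFd r) (fun r _ => hasDerivAt_radial m r)
      ((by fun_prop : Continuous fun r => -s r).intervalIntegrable _ _)
      ((continuous_dens m).intervalIntegrable _ _)
    rw [hFρ R hρ.le, radial_zero, zero_mul, mul_zero, sub_zero, zero_sub,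
      ← intervalIntegral.integral_neg] at hparts
    simp only [mul_comm (dens m _)]
    rw [hparts]
    refine intervalIntegral.integral_congr fun r _ => ?_
    simp only [hs]
    ring
  have hIG : ∫ x in Metric.ball (0 : Rn (m + 1)) R, ‖gradient (fun x => F ‖x‖) x‖ ^ 2
      ∂(gauss (m + 1)) = areaConst m * Y := by
    have hg : ∀ x : Rn (m + 1), ‖gradient (fun x => F ‖x‖) x‖ ^ 2 = s ‖x‖ ^ 2 := fun x => by
      rcases eq_or_ne x 0 with rfl | hx
      · have : (fun x : Rn (m + 1) => F ‖x‖) =ᶠ[𝓝 0] fun _ => F 0 := by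
          filter_upwards [Metric.ball_mem_nhds (0 : Rn (m + 1)) hε] with y hy
          exact hF0 _ (by simpa using hy)
        rw [norm_gradient, this.fderiv_eq]
        simp [hs0 0 hε]
      · rw [norm_gradient_comp_norm m hx (hFd ‖x‖), abs_neg, sq_abs]
    simp only [hg]
    rw [setIntegral_gauss_radial m hR.le fun r => s r ^ 2]
    congr 1
    refine intervalIntegral.integral_congr fun r hr => ?_
    rw [uIcc_of_le hR.le] at hr
    simp only [hs, mul_pow, ← dens_mul_sq m hr.1]
    ring
  have hYX : Y ≤ X := intervalIntegral.integral_mono_on hR.le hintY hintX fun r hr =>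
    mul_le_mul_of_nonneg_right (by nlinarith [h0 r, h1 r]) (integrand_nonneg m hr.1)
  have hYab : profile m b - profile m a ≤ Y := by
    have h : profile m b - profile m a = ∫ t in a..b, radial (m + 1) t ^ 2 / dens m t :=
      intervalIntegral.integral_interval_sub_left
        (intervalIntegrable_integrand m le_rfl (ha.le.trans hab.le))
        (intervalIntegrable_integrand m le_rfl ha.le)
    have h' : ∫ t in a..b, radial (m + 1) t ^ 2 / dens m t =
        ∫ t in a..b, χ t ^ 2 * (radial (m + 1) t ^ 2 / dens m t) := by
      refine intervalIntegral.integral_congr fun t ht => ?_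
      rw [uIcc_of_le hab.le] at ht
      simp [hone t ht]
    rw [h, h']
    refine intervalIntegral.integral_mono_interval ha.le hab.le hb.le ?_ hintY
    filter_upwards [ae_restrict_mem measurableSet_Ioc] with t ht
    exact mul_nonneg (sq_nonneg _) (integrand_nonneg m ht.1.le)
  have hA := areaConst_pos m
  have hYpos : 0 < Y := by linarith [profile_lt_profile m ha hab]
  refine ⟨_, ⟨_, _, htest.memWZero, ?_, rfl⟩, ?_⟩
  · rw [hIG]; positivity
  · rw [hIF, hIG, le_div_iff₀ (by positivity)]
    calc _ ≤ areaConst m * X * (areaConst m * X) := by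
          have hX0 : 0 < X := hYpos.trans_le hYX
          gcongr
          exact hYab.trans hYX
      _ = _ := by ring

/-- For the lower bound, let a → 0 and then b → R in `exists_quotient`. -/
lemma ballTorsion_eq (m : ℕ) {R : ℝ} (hR : 0 < R) :
    (torsionQuotients (Metric.ball (0 : Rn (m + 1)) R)).Nonempty ∧
    BddAbove (torsionQuotients (Metric.ball (0 : Rn (m + 1)) R)) ∧
    ballTorsion (m + 1) R = areaConst m * profile m R := by
  have hne : (torsionQuotients (Metric.ball (0 : Rn (m + 1)) R)).Nonempty := by
    obtain ⟨q, hq, -⟩ := exists_quotient m (a := R / 4) (b := R / 2) (R := R) (by linarith)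
      (by linarith) (by linarith)
    exact ⟨q, hq⟩
  have hbdd : BddAbove (torsionQuotients (Metric.ball (0 : Rn (m + 1)) R)) :=
    ⟨_, fun q hq => torsionQuotients_le m hR.le hq⟩
  refine ⟨hne, hbdd, le_antisymm (csSup_le hne fun q hq => torsionQuotients_le m hR.le hq) ?_⟩
  have h1 : ∀ a b, 0 < a → a < b → b < R →
      areaConst m * (profile m b - profile m a) ≤ ballTorsion (m + 1) R := by
    intro a b ha hab hb
    obtain ⟨q, hq, hle⟩ := exists_quotient m ha hab hb
    exact hle.trans (le_csSup hbdd hq)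
  have h2 : ∀ b, 0 < b → b < R → areaConst m * profile m b ≤ ballTorsion (m + 1) R := by
    intro b hb hbR
    have ht : Tendsto (fun a => areaConst m * (profile m b - profile m a)) (𝓝[>] 0)
        (𝓝 (areaConst m * (profile m b - 0))) :=
      ((tendsto_profile_zero m).const_sub _).const_mul _
    rw [sub_zero] at ht
    refine le_of_tendsto ht ?_
    filter_upwards [Ioo_mem_nhdsGT hb] with a ha using h1 a b ha.1 ha.2 hbR
  have ht : Tendsto (fun b => areaConst m * profile m b) (𝓝[<] R)
      (𝓝 (areaConst m * profile m R)) :=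
    ((hasDerivAt_profile m hR).continuousAt.tendsto.const_mul _).mono_left nhdsWithin_le_nhds
  refine le_of_tendsto ht ?_
  filter_upwards [Ioo_mem_nhdsLT hR] with b hb using h2 b hb.1 hb.2

lemma eqOn_ballTorsion (m : ℕ) :
    EqOn (ballTorsion (m + 1)) (fun R => areaConst m * profile m R) (Ioi 0) :=
  fun _ hR => (ballTorsion_eq m hR).2.2

/-- The factor c^a is positive and does not affect convexity. -/
lemma convexOn_ballTorsion_rpow_iff (m : ℕ) {a : ℝ} (ha : 0 < a) :
    ConvexOn ℝ (Ioi 0) (fun R => ballTorsion (m + 1) R ^ a) ↔ alpha (m + 1) ≤ a := by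
  rw [← convexOn_profile_rpow_iff m ha]
  have hA := areaConst_pos m
  have hAa : 0 < areaConst m ^ a := by positivity
  have heq : EqOn (fun R => ballTorsion (m + 1) R ^ a)
      (fun R => areaConst m ^ a • profile m R ^ a) (Ioi 0) := fun R hR => by
    simp only [eqOn_ballTorsion m hR, smul_eq_mul]
    exact Real.mul_rpow hA.le (profile_pos m hR).le
  constructor
  · intro h
    refine ((h.congr heq).smul (inv_pos.2 hAa).le).congr fun R _ => ?_
    simp [hAa.ne']
  · intro h
    exact (h.smul hAa.le).congr heq.symm

lemma deriv_ballTorsion (m : ℕ) {R : ℝ} (hR : 0 < R) :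
    deriv (ballTorsion (m + 1)) R = areaConst m * (radial (m + 1) R ^ 2 / dens m R) := by
  rw [((eqOn_ballTorsion m).eventuallyEq_of_mem (Ioi_mem_nhds hR)).deriv_eq]
  exact ((hasDerivAt_profile m hR).const_mul _).deriv

lemma iteratedDeriv_two_ballTorsion (m : ℕ) {R : ℝ} (hR : 0 < R) :
    iteratedDeriv 2 (ballTorsion (m + 1)) R = areaConst m *
      (2 * radial (m + 1) R - (m - R ^ 2) / (R * dens m R) * radial (m + 1) R ^ 2) := by
  rw [iteratedDeriv_succ, iteratedDeriv_one]
  have h : EqOn (deriv (ballTorsion (m + 1)))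
      (fun R => areaConst m * (radial (m + 1) R ^ 2 / dens m R)) (Ioi 0) :=
    fun r hr => deriv_ballTorsion m hr
  rw [(h.eventuallyEq_of_mem (Ioi_mem_nhds hR)).deriv_eq]
  exact ((hasDerivAt_integrand m hR).const_mul _).deriv

end GaussTorsion

end

theorem mainTheorem2 :
    (∀ n : ℕ, 1 ≤ n →
      -- `T_γ(B_R)` is a genuine (finite) supremum
      (∀ R : ℝ, 0 < R →
        (GaussTorsion.torsionQuotients (Metric.ball (0 : GaussTorsion.Rn n) R)).Nonempty ∧
        BddAbove (GaussTorsion.torsionQuotients (Metric.ball (0 : GaussTorsion.Rn n) R))) ∧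
      -- the explicit expression is `1 - T T'' / (T')²`
      ContDiffOn ℝ 2 (GaussTorsion.ballTorsion n) (Ioi 0) ∧
      (∀ R : ℝ, 0 < R →
        deriv (GaussTorsion.ballTorsion n) R ≠ 0 ∧
        GaussTorsion.alphaAt n R =
          1 - GaussTorsion.ballTorsion n R * iteratedDeriv 2 (GaussTorsion.ballTorsion n) R /
            deriv (GaussTorsion.ballTorsion n) R ^ 2) ∧
      -- `α_n` is a genuine (finite) supremum
      IsLUB (GaussTorsion.alphaAt n '' Ioi 0) (GaussTorsion.alpha n) ∧
      -- convexity with exponent `α_n`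
      (∀ R₀ R₁ t : ℝ, 0 < R₀ → 0 < R₁ → 0 ≤ t → t ≤ 1 →
        GaussTorsion.ballTorsion n ((1 - t) * R₀ + t * R₁) ^ GaussTorsion.alpha n ≤
          (1 - t) * GaussTorsion.ballTorsion n R₀ ^ GaussTorsion.alpha n +
            t * GaussTorsion.ballTorsion n R₁ ^ GaussTorsion.alpha n) ∧
      -- `α_n` is the smallest positive exponent with this property
      (∀ a : ℝ, 0 < a →
        (ConvexOn ℝ (Ioi 0) (fun R : ℝ => GaussTorsion.ballTorsion n R ^ a) ↔
          GaussTorsion.alpha n ≤ a)) ∧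
      1 / ((n : ℝ) + 2) ≤ GaussTorsion.alpha n ∧ GaussTorsion.alpha n ≤ 1 / 3) ∧
    GaussTorsion.alpha 1 = 1 / 3 ∧
    IsLUB (GaussTorsion.alpha '' Ici 1) (1 / 3) := by
  have hone : GaussTorsion.alpha 1 = 1 / 3 :=
    le_antisymm (GaussTorsion.alpha_le 0) (by simpa using GaussTorsion.le_alpha 0)
  refine ⟨fun n hn => ?_, hone, ?_, fun b hb => ?_⟩
  · obtain ⟨m, rfl⟩ : ∃ m, n = m + 1 := ⟨n - 1, by omega⟩
    have hA := (GaussTorsion.areaConst_pos m).ne'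
    have hle : 1 / (((m + 1 : ℕ) : ℝ) + 2) ≤ GaussTorsion.alpha (m + 1) := by
      rw [show ((m + 1 : ℕ) : ℝ) + 2 = m + 3 by push_cast; ring]
      exact GaussTorsion.le_alpha m
    refine ⟨fun R hR => ⟨(GaussTorsion.ballTorsion_eq m hR).1,
      (GaussTorsion.ballTorsion_eq m hR).2.1⟩,
      (contDiffOn_const.mul (GaussTorsion.contDiffOn_profile m)).congr
        (GaussTorsion.eqOn_ballTorsion m), fun R hR => ?_, GaussTorsion.alpha_isLUB m, ?_,
      fun a ha => GaussTorsion.convexOn_ballTorsion_rpow_iff m ha, hle, GaussTorsion.alpha_le m⟩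
    · have hT : GaussTorsion.radial (m + 1) R ^ 2 / GaussTorsion.dens m R ≠ 0 :=
        (div_pos (pow_pos (GaussTorsion.radial_pos m hR) 2) (GaussTorsion.dens_pos m hR)).ne'
      rw [GaussTorsion.deriv_ballTorsion m hR, GaussTorsion.iteratedDeriv_two_ballTorsion m hR,
        GaussTorsion.eqOn_ballTorsion m hR, GaussTorsion.alphaAt_eq_deriv m hR]
      refine ⟨mul_ne_zero hA hT, ?_⟩
      -- The ratio T T''/T'² is homogeneous of degree 0, so c cancels.
      rw [mul_pow, mul_mul_mul_comm, ← sq, mul_div_mul_left _ _ (pow_ne_zero 2 hA)]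
    · intro R₀ R₁ t h₀ h₁ ht ht'
      have hpos : 0 < GaussTorsion.alpha (m + 1) := lt_of_lt_of_le (by positivity) hle
      have h := ((GaussTorsion.convexOn_ballTorsion_rpow_iff m hpos).2 le_rfl).2
        (mem_Ioi.2 h₀) (mem_Ioi.2 h₁) (sub_nonneg.2 ht') ht (by ring)
      simpa only [smul_eq_mul] using h
  · rintro _ ⟨n, hn, rfl⟩
    obtain ⟨m, rfl⟩ : ∃ m, n = m + 1 := ⟨n - 1, by have : 1 ≤ n := hn; omega⟩
    exact GaussTorsion.alpha_le m
  -- The supremum over dimensions is attained at n = 1.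
  · exact hone ▸ hb ⟨1, mem_Ici.2 le_rfl, rfl⟩
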